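/- All graphs are finite, simple and undirected. A connected graph $\Gamma$ with vertex set $X$, distance function $d$ and diameter $D$ is \emph{distance-regular} if for $0\le i\le D$ there are integers $a_i,b_i,c_i$ such that for all $x,y\in X$ with $d(x,y)=i$, the vertex $x$ has exactly $b_i$, $a_i$, $c_i$ neighbours at distance $i+1$, $i$, $i-1$ from $y$, respectively; write $k=b_0$. A \emph{regular near $2D$-gon} is a distance-regular graph with diameter $D\ge 2$ such that for every vertex the subgraph induced on its set of neighbours is a disjoint union of cliques, and $a_i=a_1c_i$ for $1\le i\le D$; it has \emph{order} $(s,t)$ if $s=a_1+1$ and $t+1=k/(a_1+1)$. Let $\Gamma$ be distance-regular with diameter $D$ and adjacency matrix $A\in \mathrm{Mat}_X(\mathbb R)$. Its \emph{primitive idempotents} $E_0,\dots,E_D$ form the basis of the algebra $\mathbb R[A]$ with $E_0=|X|^{-1}J$ ($J$ the all-one matrix), $E_iE_j=\delta_{ij}E_i$ and $\sum_i E_i=I$. Let $\circ$ denote the entrywise product; the Krein parameters $q_{ij}^h\in\mathbb R$ are defined by $E_i\circ E_j=|X|^{-1}\sum_{h=0}^D q_{ij}^hE_h$. The graph $\Gamma$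 is \emph{$Q$-polynomial with respect to} a primitive idempotent $E$ if the primitive idempotents can be ordered as $E_0,\dots,E_D$ with $E_0=|X|^{-1}J$ and $E_1=E$ such that for $0\le h,i,j\le D$: $q_{ij}^h=0$ if one of $h,i,j$ is greater than the sum of the other two, and $q_{ij}^h\ne 0$ if one of $h,i,j$ is equal to the sum of the other two. For $x\in X$ let $\hat x\in\mathbb R^X$ be the corresponding standard basis vector. \textbf{Proposition.} For each $t\in\{1,2,4\}$ there is, up to isomorphism, exactly one regular near $4$-gon of order $(2,t)$. Let $\Gamma$ be a distance-regular graph with diameter $D=2$, and let $E$ be a primitive idempotent of $\Gamma$ with respect to which $\Gamma$ is $Q$-polynomial. Assume that there are mutually adjacent vertices $x,y,z$ of $\Gamma$ such that $E\hat x,E\hat y,E\hat z$ are linearly dependent. Then $\Gamma$ is isomorphic to the unique regular near $4$-gon of order $(2,1)$, of order $(2,2)$, or of order $(2,4)$. -/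

import Mathlib

open scoped Matrix

namespace DRG

/-- The numbers `a i`, `b i`, `c i` are the intersection numbers of `Γ`: for all vertices `x`, `y` at
distance `i`, exactly `b i` (resp. `a i`, `c i`) neighbours of `x` are at distance `i + 1`
(resp. `i`, `i - 1`) from `y`. Only the values at distances that occur in `Γ` are constrained. -/
structure HasIntersectionNumbers {X : Type*} (Γ : SimpleGraph X) (a b c : ℕ → ℕ) : Prop where
  b_eq : ∀ x y : X, {z | Γ.Adj x z ∧ Γ.dist z y = Γ.dist x y + 1}.ncard = b (Γ.dist x y)
  a_eq : ∀ x y : X, {z | Γ.Adj x z ∧ Γ.dist z y = Γ.dist x y}.ncard = a (Γ.dist x y)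
  c_eq : ∀ x y : X, {z | Γ.Adj x z ∧ Γ.dist z y + 1 = Γ.dist x y}.ncard = c (Γ.dist x y)

/-- A (finite) graph is distance-regular if it is connected and the intersection numbers exist. -/
def IsDistanceRegular {X : Type*} (Γ : SimpleGraph X) : Prop :=
  Γ.Connected ∧ ∃ a b c : ℕ → ℕ, HasIntersectionNumbers Γ a b c

/-- Every connected component is a complete graph. -/
def IsDisjointUnionOfCliques {V : Type*} (H : SimpleGraph V) : Prop :=
  ∀ u v : V, H.Reachable u v → u ≠ v → H.Adj u v

/-- Every local graph (the subgraph induced on the neighbours of a vertex) is a disjoint union of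
cliques. -/
def IsLocallyDisjointUnionOfCliques {X : Type*} (Γ : SimpleGraph X) : Prop :=
  ∀ x : X, IsDisjointUnionOfCliques (Γ.induce (Γ.neighborSet x))

/-- `Γ` is a regular near `2D`-gon: a distance-regular graph with diameter `D ≥ 2` which is locally a
disjoint union of cliques and satisfies `a i = a 1 * c i` for `1 ≤ i ≤ D`. -/
structure IsRegularNearPolygon {X : Type*} (Γ : SimpleGraph X) (D : ℕ) : Prop where
  distanceRegular : IsDistanceRegular Γ
  diam_eq : Γ.diam = D
  two_le : 2 ≤ D
  locally_cliques : IsLocallyDisjointUnionOfCliques Γ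
  a_eq_mul : ∀ a b c : ℕ → ℕ, HasIntersectionNumbers Γ a b c →
    ∀ i, 1 ≤ i → i ≤ D → a i = a 1 * c i

/-- `Γ` (distance-regular of diameter at least two, locally a disjoint union of cliques) has order
`(s, t)`: `s = a 1 + 1` and `t + 1 = k / (a 1 + 1)`, where `k = b 0` is the valency. -/
def HasOrder {X : Type*} (Γ : SimpleGraph X) (s t : ℕ) : Prop :=
  ∃ a b c : ℕ → ℕ, HasIntersectionNumbers Γ a b c ∧ s = a 1 + 1 ∧ (t + 1) * (a 1 + 1) = b 0

section Idempotents

variable {X : Type*} [Fintype X] [DecidableEq X] (Γ : SimpleGraph X) [DecidableRel Γ.Adj]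

/-- The Bose-Mesner algebra: the algebra of real matrices generated by the adjacency matrix. -/
def boseMesner : Subalgebra ℝ (Matrix X X ℝ) :=
  Algebra.adjoin ℝ {Γ.adjMatrix ℝ}

/-- `E 0, …, E D` are the primitive idempotents of `Γ`, in an ordering that starts with the trivial
one: a basis of the Bose-Mesner algebra that consists of orthogonal idempotents with sum `1`, and
`E 0` is the all-one matrix divided by the number of vertices. -/
structure IsPrimitiveIdempotents {D : ℕ} (E : Fin (D + 1) → Matrix X X ℝ) : Prop where
  linearIndependent : LinearIndependent ℝ E
  span_eq : Submodule.span ℝ (Set.range E) = Subalgebra.toSubmodule (boseMesner Γ)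
  trivial_eq : E 0 = (Fintype.card X : ℝ)⁻¹ • (Matrix.of fun _ _ => 1)
  mul_eq : ∀ i j, E i * E j = if i = j then E i else 0
  sum_eq : ∑ i, E i = 1

/-- `q i j h` are the Krein parameters of the primitive idempotents `E`; they are determined by `E`
since the matrices `E h` are linearly independent. -/
def IsKreinParameters {X : Type*} [Fintype X] {D : ℕ} (E : Fin (D + 1) → Matrix X X ℝ)
    (q : Fin (D + 1) → Fin (D + 1) → Fin (D + 1) → ℝ) : Prop :=
  ∀ i j, E i ⊙ E j = (Fintype.card X : ℝ)⁻¹ • ∑ h, q i j h • E h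

/-- `Γ` is `Q`-polynomial with respect to the ordering `E 0, …, E D` of its primitive idempotents. -/
def IsQPolynomialOrdering {D : ℕ} (E : Fin (D + 1) → Matrix X X ℝ) : Prop :=
  IsPrimitiveIdempotents Γ E ∧
    ∃ q : Fin (D + 1) → Fin (D + 1) → Fin (D + 1) → ℝ, IsKreinParameters E q ∧
      ∀ h i j : Fin (D + 1),
        (((h : ℕ) > i + j ∨ (i : ℕ) > h + j ∨ (j : ℕ) > h + i) → q i j h = 0) ∧
        (((h : ℕ) = i + j ∨ (i : ℕ) = h + j ∨ (j : ℕ) = h + i) → q i j h ≠ 0)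

/-- `Γ`, of diameter `D ≥ 1`, is `Q`-polynomial with respect to the primitive idempotent `E`: there is
a `Q`-polynomial ordering `F 0, …, F D` of the primitive idempotents with `F 1 = E`. -/
def IsQPolynomial (D : ℕ) (E : Matrix X X ℝ) : Prop :=
  ∃ F : Fin (D + 1) → Matrix X X ℝ, IsQPolynomialOrdering Γ F ∧ F 1 = E

end Idempotents

end DRG

/-!
Call a graph a quadrangle if any two adjacent vertices have exactly one common neighbour (so that
the maximal cliques are lines with three points) and every vertex off a line has exactly one
neighbour on it (`IsQuadrangle`). A regular near 4-gon of order `(2, t)` is the same thing as a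
quadrangle that is regular of valency `2 * (t + 1)`
(`IsRegularNearPolygon.isQuadrangle`, `IsQuadrangle.isRegularNearPolygon`).

**Dependent triangles.** The primitive idempotent `E` has one entry `e0` on the diagonal, one entry
`e1` for adjacent and one entry `e2` for distinct nonadjacent vertices, and it is the Gram matrix of
its own rows. A dependence between the columns of a triangle forces `e0 + 2 * e1 = 0`, and then the
columns of *every* triangle have sum `0`. Comparing entries, a vertex off a triangle has exactly one
neighbour on it, unless `e2 = e0` or `e2 = 0`. In the first case `E ⊙ E` is a combination of `E` and
the all-one matrix, which contradicts `q 1 1 2 ≠ 0`; in the second the triangle is a connected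
component. So the graph is a quadrangle (`isQuadrangle_of_not_linearIndependent`).

**Classification.** Fix two nonadjacent vertices `x`, `y` of a quadrangle of order `(2, t)`, their
common neighbours `p 0, …, p t`, the third points `p' i` and `q i` of the lines `x p i` and `y p i`.
A vertex `r` that is far from `x` and `y` and misses `p k` and `p l` for some `k ≠ l` is the third
point of the line `p' k q l`; it follows that `r` misses either none or exactly two of the `p i`.
Passing to the third point of the line through `r` and `p i` complements the set of
`p j`, `j ≠ i`, that are missed, and comparing sizes leaves only `t = 1, 2, 4`
(`IsFrame.order_mem`).

For uniqueness, the indicator of being distinct and nonadjacent, with values in `ZMod 2`, is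
additive along lines in each argument. The vertices `x`, `y`, `p i` generate the quadrangle
(`IsFrame.induction`), so the indicator is the bilinear form `Coord.form` evaluated at the
coordinate vectors of the two vertices (`IsFrame.far_eq_form`). This identifies the quadrangle with an explicit
graph on the singular vectors of a quadratic form (for `t = 2`, on the nonzero vectors of a
symplectic space), since both have `3 * (2 * t + 1)` vertices. For `t = 1, 2, 4` the explicit graph
is a quadrangle, which gives existence.
-/

namespace DRG

/-! ### Quadrangles with three points on each line, and frames -/

/-- The collinearity graph of a (possibly degenerate) generalized quadrangle with three points on
each line. The lines are the triangles: two adjacent points `a`, `b` lie on a unique line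
`{a, b, c}`, and every point off a line is adjacent to a point of it; by `third_unique` there is
only one such point. -/
structure IsQuadrangle {X : Type*} (Γ : SimpleGraph X) : Prop where
  exists_third : ∀ {a b}, Γ.Adj a b → ∃ c, Γ.Adj a c ∧ Γ.Adj b c
  third_unique : ∀ {a b c d}, Γ.Adj a b → Γ.Adj a c → Γ.Adj b c → Γ.Adj a d → Γ.Adj b d → c = d
  exists_adj : ∀ {a b c}, Γ.Adj a b → Γ.Adj a c → Γ.Adj b c → ∀ {w}, w ≠ a → w ≠ b → w ≠ c →
    Γ.Adj w a ∨ Γ.Adj w b ∨ Γ.Adj w c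

theorem IsQuadrangle.of_iso {V W : Type*} {G : SimpleGraph V} {G' : SimpleGraph W}
    (h : IsQuadrangle G) (e : G ≃g G') : IsQuadrangle G' where
  exists_third {a b} hab := by
    obtain ⟨c, hc⟩ := h.exists_third (e.symm.map_adj_iff.2 hab)
    exact ⟨e c, by simpa [← e.symm.map_adj_iff] using hc⟩
  third_unique hab hac hbc had hbd := e.symm.injective <| by
    rw [← e.symm.map_adj_iff] at hab hac hbc had hbd
    exact h.third_unique hab hac hbc had hbd
  exists_adj hab hac hbc w ha hb hc := by
    rw [← e.symm.map_adj_iff] at hab hac hbc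
    simpa only [e.symm.map_adj_iff] using
      h.exists_adj hab hac hbc (w := e.symm w) (by simpa) (by simpa) (by simpa)

/-- Two nonadjacent points `x`, `y`, their common neighbours `p i`, the third point `p' i` of the
line through `x` and `p i`, and the third point `q i` of the line through `y` and `p i`.
In what follows, a point is far from another one if the two are distinct and nonadjacent, and a
point far from `x` and `y` misses `p i` if it is not adjacent to it. -/
structure IsFrame {X ι : Type*} (Γ : SimpleGraph X) (x y : X) (p p' q : ι → X) : Prop where
  ne : x ≠ y
  not_adj : ¬ Γ.Adj x y
  injective : Function.Injective p
  adj_left : ∀ i, Γ.Adj x (p i)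
  adj_right : ∀ i, Γ.Adj y (p i)
  complete : ∀ {w}, Γ.Adj x w → Γ.Adj y w → ∃ i, w = p i
  adj_left' : ∀ i, Γ.Adj x (p' i)
  adj_p_p' : ∀ i, Γ.Adj (p i) (p' i)
  adj_right' : ∀ i, Γ.Adj y (q i)
  adj_p_q : ∀ i, Γ.Adj (p i) (q i)

namespace IsFrame

variable {X ι : Type*} {Γ : SimpleGraph X} {x y : X} {p p' q : ι → X}

theorem symm (F : IsFrame Γ x y p p' q) : IsFrame Γ y x p q p' where
  ne := F.ne.symm
  not_adj h := F.not_adj h.symm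
  injective := F.injective
  adj_left := F.adj_right
  adj_right := F.adj_left
  complete h h' := F.complete h' h
  adj_left' := F.adj_right'
  adj_p_p' := F.adj_p_q
  adj_right' := F.adj_left'
  adj_p_q := F.adj_p_p'

theorem not_adj_right_p' (F : IsFrame Γ x y p p' q) (h : IsQuadrangle Γ) (i : ι) :
    ¬ Γ.Adj y (p' i) := fun hy =>
  F.ne (h.third_unique (F.adj_p_p' i) (F.adj_left i).symm (F.adj_left' i).symm
    (F.adj_right i).symm hy.symm)

theorem not_adj_p_p (F : IsFrame Γ x y p p' q) (h : IsQuadrangle Γ) (i j : ι) :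
    ¬ Γ.Adj (p i) (p j) := fun hp =>
  F.ne (h.third_unique hp (F.adj_left i).symm (F.adj_left j).symm
    (F.adj_right i).symm (F.adj_right j).symm)

theorem not_adj_p'_p (F : IsFrame Γ x y p p' q) (h : IsQuadrangle Γ) {i j : ι} (hij : i ≠ j) :
    ¬ Γ.Adj (p' i) (p j) := fun hp =>
  hij (F.injective (h.third_unique (F.adj_left' i) (F.adj_left i) (F.adj_p_p' i).symm
    (F.adj_left j) hp))

theorem adj_p'_q (F : IsFrame Γ x y p p' q) (h : IsQuadrangle Γ) {i j : ι} (hij : i ≠ j) :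
    Γ.Adj (p' i) (q j) := by
  have h1 := F.not_adj_right_p' h i
  have h2 := F.not_adj_p'_p h hij
  have h3 := F.symm.not_adj_right_p' h j
  rcases h.exists_adj (F.adj_right j) (F.adj_right' j) (F.adj_p_q j) (w := p' i)
    (by rintro h; exact F.not_adj (h ▸ F.adj_left' i))
    (by rintro h; exact h1 (h ▸ F.adj_right j)) (by rintro h; exact h1 (h ▸ F.adj_right' j))
    with h' | h' | h'
  · exact absurd h'.symm h1
  · exact absurd h' h2
  · exact h'

theorem not_adj_p'_q (F : IsFrame Γ x y p p' q) (h : IsQuadrangle Γ) (i : ι) :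
    ¬ Γ.Adj (p' i) (q i) := fun hp =>
  F.not_adj (h.third_unique (F.adj_p_p' i) (F.adj_left i).symm (F.adj_left' i).symm
    (F.adj_p_q i) hp ▸ F.adj_right' i).symm

theorem eq_p_or_p'_of_adj (F : IsFrame Γ x y p p' q) (h : IsQuadrangle Γ) {w : X}
    (hw : Γ.Adj x w) : ∃ i, w = p i ∨ w = p' i := by
  obtain ⟨c, hxc, hwc⟩ := h.exists_third hw
  rcases h.exists_adj hw hxc hwc (w := y) F.ne.symm
    (by rintro rfl; exact F.not_adj hw) (by rintro rfl; exact F.not_adj hxc) with h' | h' | h'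
  · exact absurd h'.symm F.not_adj
  · obtain ⟨i, rfl⟩ := F.complete hw h'
    exact ⟨i, .inl rfl⟩
  · obtain ⟨i, rfl⟩ := F.complete hxc h'
    exact ⟨i, .inr (h.third_unique hxc hw hwc.symm (F.adj_left' i) (F.adj_p_p' i))⟩

/-- A point far from `x` is adjacent to one of the other two points on the line through `x` and
`p i`. -/
theorem adj_p' (F : IsFrame Γ x y p p' q) (h : IsQuadrangle Γ) {r : X} (hne : r ≠ x)
    (hx : ¬ Γ.Adj x r) {i : ι} (hi : ¬ Γ.Adj r (p i)) : Γ.Adj r (p' i) := by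
  rcases h.exists_adj (F.adj_left i) (F.adj_left' i) (F.adj_p_p' i) (w := r) hne
    (by rintro rfl; exact hx (F.adj_left i)) (by rintro rfl; exact hx (F.adj_left' i))
    with h' | h' | h'
  · exact absurd h'.symm hx
  · exact absurd h' hi
  · exact h'

/-- If `r` is far from `x` and `y` and misses `p k` and `p l`, then it is adjacent to `p' k` and
`q l`; for `k ≠ l` this makes it the third point of the line through them. -/
theorem adj_p'_and_q (F : IsFrame Γ x y p p' q) (h : IsQuadrangle Γ) {r : X}
    (hrx : r ≠ x) (hry : r ≠ y) (hx : ¬ Γ.Adj x r) (hy : ¬ Γ.Adj y r)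
    {k l : ι} (hk : ¬ Γ.Adj r (p k)) (hl : ¬ Γ.Adj r (p l)) :
    Γ.Adj (p' k) r ∧ Γ.Adj (q l) r :=
  ⟨(F.adj_p' h hrx hx hk).symm, (F.symm.adj_p' h hry hy hl).symm⟩

/-- A point far from `x` and `y` misses at most two of the `p i`: if it misses `p k` and `p l`, it
is on the line through `p' k` and `q l`, and there is only one line through `p' k` and `r`. -/
theorem eq_of_not_adj (F : IsFrame Γ x y p p' q) (h : IsQuadrangle Γ) {r : X}
    (hrx : r ≠ x) (hry : r ≠ y) (hx : ¬ Γ.Adj x r) (hy : ¬ Γ.Adj y r)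
    {k l m : ι} (hk : ¬ Γ.Adj r (p k)) (hl : ¬ Γ.Adj r (p l)) (hm : ¬ Γ.Adj r (p m))
    (hkl : k ≠ l) (hkm : k ≠ m) : l = m := by
  obtain ⟨h1, h2⟩ := F.adj_p'_and_q h hrx hry hx hy hk hl
  obtain ⟨-, h3⟩ := F.adj_p'_and_q h hrx hry hx hy hk hm
  have hq : q l = q m :=
    h.third_unique h1 (F.adj_p'_q h hkl) h2.symm (F.adj_p'_q h hkm) h3.symm
  exact F.injective (h.third_unique (F.adj_right' l) (F.adj_right l) (F.adj_p_q l).symm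
    (F.adj_right m) (hq ▸ (F.adj_p_q m).symm))

/-- A point `r` far from `x` and `y` does not miss exactly one of the `p i`: the line through `r`
and `p' k` meets the neighbourhood of `y` in some `q l`, and `r` misses `p l`. -/
theorem exists_ne_not_adj (F : IsFrame Γ x y p p' q) (h : IsQuadrangle Γ) {r : X}
    (hrx : r ≠ x) (hry : r ≠ y) (hx : ¬ Γ.Adj x r) (hy : ¬ Γ.Adj y r)
    {k : ι} (hk : ¬ Γ.Adj r (p k)) : ∃ l, l ≠ k ∧ ¬ Γ.Adj r (p l) := by
  have hr := F.adj_p' h hrx hx hk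
  obtain ⟨w, hrw, hpw⟩ := h.exists_third hr
  have hyw : Γ.Adj y w := by
    rcases h.exists_adj hr hrw hpw (w := y) hry.symm
      (by rintro e; exact F.not_adj (e ▸ F.adj_left' k)) (by rintro rfl; exact hy hrw.symm)
      with h' | h' | h'
    · exact absurd h' hy
    · exact absurd h' (F.not_adj_right_p' h k)
    · exact h'
  obtain ⟨j, rfl | rfl⟩ := F.symm.eq_p_or_p'_of_adj h hyw
  · by_cases hkj : k = j
    · subst hkj
      exact absurd hrw hk
    · exact absurd hpw (F.not_adj_p'_p h hkj)
  · refine ⟨j, ?_, fun hrj => hry ?_⟩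
    · rintro rfl
      exact F.not_adj_p'_q h _ hpw
    · exact h.third_unique (F.adj_p_q j) hrj.symm hrw.symm (F.adj_right j).symm
        (F.adj_right' j).symm

/-- Moving from a far point `r` to the third point `s` of the line through `r` and `p i` gives
again a far point, and complements the set of `p j` with `j ≠ i` that are missed. -/
theorem reflect (F : IsFrame Γ x y p p' q) (h : IsQuadrangle Γ) {r s : X} {i : ι}
    (hrx : r ≠ x) (hry : r ≠ y) (hx : ¬ Γ.Adj x r) (hy : ¬ Γ.Adj y r)
    (hri : Γ.Adj r (p i)) (hrs : Γ.Adj r s) (his : Γ.Adj (p i) s) :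
    s ≠ x ∧ s ≠ y ∧ ¬ Γ.Adj x s ∧ ¬ Γ.Adj y s ∧ ∀ j, j ≠ i → (Γ.Adj s (p j) ↔ ¬ Γ.Adj r (p j)) := by
  refine ⟨?_, ?_, fun hs => hrx ?_, fun hs => hry ?_,
    fun j hj => ⟨fun h1 h2 => hj ?_, fun h1 => ?_⟩⟩
  · rintro rfl
    exact hx hrs.symm
  · rintro rfl
    exact hy hrs.symm
  · exact h.third_unique his hri.symm hrs.symm (F.adj_left i).symm hs.symm
  · exact h.third_unique his hri.symm hrs.symm (F.adj_right i).symm hs.symm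
  · exact F.injective (h.third_unique hrs h2 h1 hri his.symm)
  · rcases h.exists_adj hri hrs his (w := p j) (by rintro rfl; exact hx (F.adj_left j))
      (fun e => hj (F.injective e)) (by rintro rfl; exact F.not_adj_p_p h i j his) with h' | h' | h'
    · exact absurd h'.symm h1
    · exact absurd h' (F.not_adj_p_p h _ _)
    · exact h'.symm

/-- A frame generates the quadrangle: a set of points that contains the frame and, with two points
of a line, also the third one, contains every point. -/
theorem induction [Nontrivial ι] (F : IsFrame Γ x y p p' q) (h : IsQuadrangle Γ) {P : X → Prop}
    (hx : P x) (hy : P y) (hp : ∀ i, P (p i))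
    (third : ∀ a b c, Γ.Adj a b → Γ.Adj a c → Γ.Adj b c → P a → P b → P c) (w : X) : P w := by
  have hp' i : P (p' i) := third _ _ _ (F.adj_left i) (F.adj_left' i) (F.adj_p_p' i) hx (hp i)
  have hq i : P (q i) := third _ _ _ (F.adj_right i) (F.adj_right' i) (F.adj_p_q i) hy (hp i)
  by_cases hwx : w = x
  · exact hwx ▸ hx
  by_cases hwy : w = y
  · exact hwy ▸ hy
  by_cases hxw : Γ.Adj x w
  · obtain ⟨i, rfl | rfl⟩ := F.eq_p_or_p'_of_adj h hxw
    exacts [hp i, hp' i]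
  by_cases hyw : Γ.Adj y w
  · obtain ⟨i, rfl | rfl⟩ := F.symm.eq_p_or_p'_of_adj h hyw
    exacts [hp i, hq i]
  have key : ∀ r, r ≠ x → r ≠ y → ¬ Γ.Adj x r → ¬ Γ.Adj y r → (∃ k, ¬ Γ.Adj r (p k)) → P r := by
    rintro r hrx hry hx hy ⟨k, hk⟩
    obtain ⟨l, hlk, hl⟩ := F.exists_ne_not_adj h hrx hry hx hy hk
    obtain ⟨h1, h2⟩ := F.adj_p'_and_q h hrx hry hx hy hk hl
    exact third _ _ _ (F.adj_p'_q h hlk.symm) h1 h2 (hp' k) (hq l)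
  by_cases hk : ∃ k, ¬ Γ.Adj w (p k)
  · exact key w hwx hwy hxw hyw hk
  -- If `w` is adjacent to all `p k`, the other points on the line through `w` and `p i` are not.
  push Not at hk
  obtain ⟨i, j, hij⟩ := exists_pair_ne ι
  obtain ⟨s, hws, his⟩ := h.exists_third (hk i)
  obtain ⟨h1, h2, h3, h4, h5⟩ := F.reflect h hwx hwy hxw hyw (hk i) hws his
  exact third _ _ _ his.symm hws.symm (hk i).symm
    (key s h1 h2 h3 h4 ⟨j, fun hs => (h5 j hij.symm).1 hs (hk j)⟩) (hp i)

end IsFrame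

/-! ### The order, and the number of points -/

namespace IsFrame

variable {X ι : Type*} {Γ : SimpleGraph X} {x y : X} {p p' q : ι → X}

/-- The common neighbour `r` of `p' k` and `q l` is far from `x` and misses `p k`. The same facts
for `y` and `p l` follow from `IsFrame.symm`. -/
theorem far_of_adj (F : IsFrame Γ x y p p' q) (h : IsQuadrangle Γ) {r : X} {k l : ι}
    (hkl : k ≠ l) (hk : Γ.Adj (p' k) r) (hl : Γ.Adj (q l) r) :
    r ≠ x ∧ ¬ Γ.Adj x r ∧ ¬ Γ.Adj r (p k) := by
  refine ⟨?_, fun hx => ?_, fun hp => ?_⟩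
  · rintro rfl
    exact F.symm.not_adj_right_p' h l hl.symm
  · have := h.third_unique hk (F.adj_left' k).symm hx.symm (F.adj_p'_q h hkl) hl.symm
    exact F.not_adj (this ▸ (F.adj_right' l)).symm
  · have := h.third_unique (F.adj_p_p' k) (F.adj_left k).symm (F.adj_left' k).symm hp.symm hk
    exact F.symm.not_adj_right_p' h l (this ▸ hl.symm)

theorem injective' (F : IsFrame Γ x y p p' q) (h : IsQuadrangle Γ) :
    Function.Injective p' := fun i j hij =>
  F.injective (h.third_unique (F.adj_left' i) (F.adj_left i) (F.adj_p_p' i).symm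
    (F.adj_left j) (hij ▸ (F.adj_p_p' j).symm))

/-- Every line through `x` carries exactly one common neighbour of `x` and `y`. -/
theorem ncard_neighborSet [Finite ι] (F : IsFrame Γ x y p p' q) (h : IsQuadrangle Γ) :
    (Γ.neighborSet x).ncard = 2 * Nat.card ι := by
  let f : ι ⊕ ι → Γ.neighborSet x :=
    Sum.elim (fun i => ⟨p i, F.adj_left i⟩) (fun i => ⟨p' i, F.adj_left' i⟩)
  have hf : Function.Bijective f := by
    constructor
    · rintro (i | i) (j | j) hij <;>
        replace hij := congrArg Subtype.val hij <;>
        simp only [f, Sum.elim_inl, Sum.elim_inr] at hij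
      · rw [F.injective hij]
      · exact absurd (hij ▸ F.adj_right i) (F.not_adj_right_p' h j)
      · exact absurd (hij ▸ F.adj_right j) (F.not_adj_right_p' h i)
      · rw [F.injective' h hij]
    · rintro ⟨w, hw⟩
      obtain ⟨i, rfl | rfl⟩ := F.eq_p_or_p'_of_adj h hw
      exacts [⟨.inl i, rfl⟩, ⟨.inr i, rfl⟩]
  rw [← Nat.card_coe_set_eq, ← Nat.card_congr (Equiv.ofBijective f hf), Nat.card_sum, two_mul]

theorem comp_equiv {κ : Type*} (F : IsFrame Γ x y p p' q) (e : κ ≃ ι) :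
    IsFrame Γ x y (p ∘ e) (p' ∘ e) (q ∘ e) where
  ne := F.ne
  not_adj := F.not_adj
  injective := F.injective.comp e.injective
  adj_left _ := F.adj_left _
  adj_right _ := F.adj_right _
  complete h h' := by
    obtain ⟨i, rfl⟩ := F.complete h h'
    exact ⟨e.symm i, by simp⟩
  adj_left' _ := F.adj_left' _
  adj_p_p' _ := F.adj_p_p' _
  adj_right' _ := F.adj_right' _
  adj_p_q _ := F.adj_p_q _

/-- Let `r` be the third point on the line through `p' 0` and `q 1`. It misses `p 0` and `p 1`,
and no other `p k`. Passing to the third point on the line through `r` and `p 2` gives a point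
that misses exactly `p 3, …, p t`, so this list is empty or has length two. -/
theorem order_mem {t : ℕ} (ht : 1 ≤ t) {p p' q : Fin (t + 1) → X}
    (F : IsFrame Γ x y p p' q) (h : IsQuadrangle Γ) : t = 1 ∨ t = 2 ∨ t = 4 := by
  by_contra! hcon
  have h2 : 2 < t := by lia
  let i (k : ℕ) (hk : k < t + 1) : Fin (t + 1) := ⟨k, hk⟩
  have hi {k l : ℕ} {hk hl} (hkl : k ≠ l) : i k hk ≠ i l hl := fun e => hkl (Fin.mk.inj_iff.1 e)
  obtain ⟨r, hr0, hr1⟩ := h.exists_third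
    (F.adj_p'_q h (hi (k := 0) (l := 1) (hk := by lia) (hl := by lia) (by simp)))
  obtain ⟨hrx, hx, n0⟩ := F.far_of_adj h (hi (by simp)) hr0 hr1
  obtain ⟨hry, hy, n1⟩ := F.symm.far_of_adj h (hi (by simp)) hr1 hr0
  have a2 {k : ℕ} (hk : k < t + 1) (h2 : 2 ≤ k) : Γ.Adj r (p (i k hk)) := by
    by_contra hk'
    exact hi (by lia) (F.eq_of_not_adj h hrx hry hx hy n0 n1 hk' (hi (by lia)) (hi (by lia)))
  have r2 := a2 (k := 2) (by lia) le_rfl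
  obtain ⟨s, hrs, hs2⟩ := h.exists_third r2
  obtain ⟨hsx, hsy, hx', hy', hs⟩ := F.reflect h hrx hry hx hy r2 hrs hs2
  have s3 {k : ℕ} (hk : k < t + 1) (h3 : 3 ≤ k) : ¬ Γ.Adj s (p (i k hk)) := by
    rw [hs _ (hi (by lia)), not_not]
    exact a2 _ (by lia)
  have s0 {k : ℕ} (hk : k < t + 1) (h3 : k < 3) : Γ.Adj s (p (i k hk)) := by
    by_cases hk2 : k = 2
    · subst hk2
      exact hs2.symm
    rw [hs _ (hi (by lia))]
    obtain rfl | rfl : k = 0 ∨ k = 1 := by lia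
    exacts [n0, n1]
  obtain ⟨⟨l, hl⟩, hl3, hsl⟩ := F.exists_ne_not_adj h hsx hsy hx' hy' (s3 (k := 3) (by lia) le_rfl)
  have hl3' : l ≠ 3 := fun e => hl3 (Fin.ext e)
  have hl' : ¬ l < 3 := fun hl' => hsl (s0 hl hl')
  exact hi (by lia) (F.eq_of_not_adj h hsx hsy hx' hy' (s3 (k := 3) (by lia) le_rfl)
    (s3 (k := 4) (by lia) (by lia)) (s3 (k := 5) (by lia) (by lia)) (hi (by lia)) (hi (by lia)))

end IsFrame

namespace IsQuadrangle

variable {X : Type*} {Γ : SimpleGraph X}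

theorem exists_isFrame (h : IsQuadrangle Γ) {x y : X} (hne : x ≠ y) (hxy : ¬ Γ.Adj x y) :
    ∃ p' q, IsFrame Γ x y (Subtype.val : {w // Γ.Adj x w ∧ Γ.Adj y w} → X) p' q := by
  choose p' hp' using fun i : {w // Γ.Adj x w ∧ Γ.Adj y w} => h.exists_third i.2.1
  choose q hq using fun i : {w // Γ.Adj x w ∧ Γ.Adj y w} => h.exists_third i.2.2
  exact ⟨p', q, hne, hxy, Subtype.val_injective, fun i => i.2.1, fun i => i.2.2,
    fun hx hy => ⟨⟨_, hx, hy⟩, rfl⟩, fun i => (hp' i).1, fun i => (hp' i).2,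
    fun i => (hq i).1, fun i => (hq i).2⟩

theorem ncard_neighborSet_eq [Finite X] (h : IsQuadrangle Γ) {x y : X} (hne : x ≠ y)
    (hxy : ¬ Γ.Adj x y) :
    (Γ.neighborSet x).ncard = 2 * {w | Γ.Adj x w ∧ Γ.Adj y w}.ncard := by
  obtain ⟨p', q, F⟩ := h.exists_isFrame hne hxy
  rw [F.ncard_neighborSet h, ← Nat.card_coe_set_eq]
  rfl

theorem exists_isFrame_fin [Finite X] (h : IsQuadrangle Γ) {t : ℕ}
    (hdeg : ∀ x, (Γ.neighborSet x).ncard = 2 * (t + 1)) {x y : X} (hne : x ≠ y)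
    (hxy : ¬ Γ.Adj x y) : ∃ p p' q : Fin (t + 1) → X, IsFrame Γ x y p p' q := by
  obtain ⟨p', q, F⟩ := h.exists_isFrame hne hxy
  have hcard := F.ncard_neighborSet h
  rw [hdeg] at hcard
  exact ⟨_, _, _, F.comp_equiv (Finite.equivFinOfCardEq (by lia)).symm⟩

theorem exists_not_adj [Finite X] [Nonempty X] (h : IsQuadrangle Γ) {t : ℕ} (ht : 1 ≤ t)
    (hdeg : ∀ x, (Γ.neighborSet x).ncard = 2 * (t + 1)) (x : X) : ∃ y, x ≠ y ∧ ¬ Γ.Adj x y := by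
  obtain ⟨a, ha : Γ.Adj x a⟩ := Set.nonempty_of_ncard_ne_zero (s := Γ.neighborSet x)
    (by rw [hdeg]; lia)
  by_contra! hall
  obtain ⟨c, hxc, hac⟩ := h.exists_third ha
  have hsub : Γ.neighborSet a ⊆ {x, c} := by
    intro w (hw : Γ.Adj a w)
    by_cases hwx : w = x
    · simp [hwx]
    · simp [h.third_unique ha (hall w (Ne.symm hwx)) hw hxc hac]
  have := (Set.ncard_le_ncard hsub).trans (Set.ncard_insert_le x {c})
  rw [hdeg, Set.ncard_singleton] at this
  lia

/-- Every line has three points, and every point off a given line has exactly one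
neighbour on it. -/
theorem card_eq [Fintype X] [Nonempty X] (h : IsQuadrangle Γ) {t : ℕ}
    (hdeg : ∀ x, (Γ.neighborSet x).ncard = 2 * (t + 1)) : Fintype.card X = 3 * (2 * t + 1) := by
  classical
  obtain ⟨a⟩ := ‹Nonempty X›
  obtain ⟨b, hab : Γ.Adj a b⟩ := Set.nonempty_of_ncard_ne_zero (s := Γ.neighborSet a)
    (by rw [hdeg]; lia)
  obtain ⟨c, hac, hbc⟩ := h.exists_third hab
  have hd (x : X) : ∑ w, (if Γ.Adj w x then 1 else 0) = 2 * (t + 1) := by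
    rw [← hdeg x, Set.ncard_eq_toFinset_card', Finset.sum_boole]
    simp [Γ.adj_comm]
  have hw (w : X) : (if Γ.Adj w a then 1 else 0) + (if Γ.Adj w b then 1 else 0) +
      (if Γ.Adj w c then 1 else 0) =
      1 + ((if w = a then 1 else 0) + (if w = b then 1 else 0) + (if w = c then 1 else 0)) := by
    by_cases ha : w = a
    · subst ha; simp [hab, hac, hab.ne, hac.ne]
    by_cases hb : w = b
    · subst hb; simp [hab.symm, hbc, hbc.ne, ha]
    by_cases hc : w = c
    · subst hc; simp [hac.symm, hbc.symm, ha, hb]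
    have h1 : ¬ (Γ.Adj w a ∧ Γ.Adj w b) := fun hh => hc
      (h.third_unique hab hh.1.symm hh.2.symm hac hbc)
    have h2 : ¬ (Γ.Adj w a ∧ Γ.Adj w c) := fun hh => hb
      (h.third_unique hac hh.1.symm hh.2.symm hab hbc.symm)
    have h3 : ¬ (Γ.Adj w b ∧ Γ.Adj w c) := fun hh => ha
      (h.third_unique hbc hh.1.symm hh.2.symm hab.symm hac.symm)
    have h4 := h.exists_adj hab hac hbc ha hb hc
    simp only [ha, hb, hc]
    split_ifs <;> simp_all
  have := Finset.sum_congr (rfl : (Finset.univ : Finset X) = _) fun w _ => hw w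
  simp only [Finset.sum_add_distrib, hd, Finset.sum_ite_eq', Finset.mem_univ, if_true,
    Finset.sum_const, Finset.card_univ, smul_eq_mul] at this
  lia

end IsQuadrangle

/-! ### Coordinates over the field with two elements -/

/-- The vector space in which quadrangles of order `(2, t)` are coordinatized: a hyperbolic plane
plus one coordinate for each of the `t + 1` common neighbours in a frame. -/
abbrev Coord (t : ℕ) : Type := ZMod 2 × ZMod 2 × (Fin (t + 1) → ZMod 2)

namespace Coord

variable {t : ℕ}

/-- The alternating form on coordinate vectors that vanishes exactly at pairs of equal or adjacent
points. -/
def form (u v : Coord t) : ZMod 2 :=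
  u.1 * v.2.1 + u.2.1 * v.1 + (∑ i, u.2.2 i) * (∑ i, v.2.2 i) + ∑ i, u.2.2 i * v.2.2 i

/-- A quadratic form which, for `t = 1` and `t = 4`, polarizes to `form`. -/
def quad (u : Coord t) : ZMod 2 :=
  u.1 * u.2.1 + ∑ i, ∑ j, if j < i then u.2.2 i * u.2.2 j else 0

theorem form_comm (u v : Coord t) : form u v = form v u := by
  simp only [form, mul_comm (v.2.2 _)]
  ring

theorem form_self (u : Coord t) : form u u = 0 := by
  have h : ∀ a : ZMod 2, a * a = a := by decide
  simp only [form, h, mul_comm u.2.1, CharTwo.add_self_eq_zero, zero_add]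

theorem form_add_right (u v w : Coord t) : form u (v + w) = form u v + form u w := by
  simp only [form, Prod.fst_add, Prod.snd_add, Pi.add_apply, mul_add, Finset.sum_add_distrib]
  ring

theorem quad_add (ht : t = 1 ∨ t = 4) (u v : Coord t) :
    quad (u + v) = quad u + quad v + form u v := by
  have h2 : (2 : ZMod 2) = 0 := rfl
  rcases ht with rfl | rfl
  · simp [quad, form, Fin.sum_univ_succ]
    linear_combination (-u.2.2 0 * v.2.2 0 - u.2.2 1 * v.2.2 1) * h2
  · simp [quad, form, Fin.sum_univ_succ]
    linear_combination (-u.2.2 0 * v.2.2 0 - u.2.2 1 * v.2.2 1 - u.2.2 2 * v.2.2 2 -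
      u.2.2 3 * v.2.2 3 - u.2.2 4 * v.2.2 4) * h2

/-- The nonzero vectors that occur as coordinates of points of a quadrangle of order `(2, t)`. For
`t = 1` and `t = 4` they are the points of the hyperbolic quadric in dimension 4 and of the elliptic
quadric in dimension 6. For `t = 2` they are all nonzero vectors of a symplectic space of dimension
4, and no quadratic condition is imposed. -/
def IsPoint (u : Coord t) : Prop :=
  u ≠ 0 ∧ (Even t → ∑ i, u.2.2 i = 0) ∧ (t ≠ 2 → quad u = 0)

instance : DecidablePred (IsPoint (t := t)) := fun _ => inferInstanceAs (Decidable (_ ∧ _ ∧ _))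

theorem add_self (u : Coord t) : u + u = 0 := by
  ext <;> simp [CharTwo.add_self_eq_zero]

theorem IsPoint.add (ht : t = 1 ∨ t = 2 ∨ t = 4) {u v : Coord t} (hu : IsPoint u)
    (hv : IsPoint v) (hne : u ≠ v) (h : form u v = 0) : IsPoint (u + v) := by
  refine ⟨fun h0 => hne ?_, fun he => ?_, fun h2 => ?_⟩
  · rw [← add_zero u, ← add_self v, ← add_assoc, h0, zero_add]
  · simp [Finset.sum_add_distrib, hu.2.1 he, hv.2.1 he]
  · rw [quad_add (by tauto), hu.2.2 h2, hv.2.2 h2, h]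
    rfl

set_option maxRecDepth 100000 in
theorem card_isPoint (ht : t = 1 ∨ t = 2 ∨ t = 4) :
    Fintype.card {u : Coord t // IsPoint u} = 3 * (2 * t + 1) := by
  rcases ht with rfl | rfl | rfl <;> decide +kernel

set_option maxRecDepth 100000 in
set_option synthInstance.maxHeartbeats 400000 in
set_option synthInstance.maxSize 4000 in
/-- There is no totally singular subspace of dimension 3. -/
theorem eq_or_eq_or_eq_add (ht : t = 1 ∨ t = 2 ∨ t = 4) :
    ∀ u v : {u : Coord t // IsPoint u}, u ≠ v → form u.1 v.1 = 0 →
      ∀ w : {u : Coord t // IsPoint u}, form u.1 w.1 = 0 → form v.1 w.1 = 0 →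
        w.1 = u.1 ∨ w.1 = v.1 ∨ w.1 = u.1 + v.1 := by
  rcases ht with rfl | rfl | rfl <;> decide +kernel

set_option maxRecDepth 100000 in
theorem card_perp (ht : t = 1 ∨ t = 2 ∨ t = 4) :
    ∀ u : {u : Coord t // IsPoint u},
      Fintype.card {v : {u : Coord t // IsPoint u} // u ≠ v ∧ form u.1 v.1 = 0} = 2 * (t + 1) := by
  rcases ht with rfl | rfl | rfl <;> decide +kernel

/-- The explicit quadrangle of order `(2, t)` for `t = 1, 2, 4`: its vertices are the points,
adjacent when they are distinct and orthogonal. -/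
def graph (t : ℕ) : SimpleGraph {u : Coord t // IsPoint u} where
  Adj u v := u ≠ v ∧ form u.1 v.1 = 0
  symm := ⟨fun _ _ h => ⟨h.1.symm, form_comm _ _ ▸ h.2⟩⟩
  loopless := ⟨fun _ h => h.1 rfl⟩

theorem ncard_neighborSet_graph (ht : t = 1 ∨ t = 2 ∨ t = 4) (u : {u : Coord t // IsPoint u}) :
    ((graph t).neighborSet u).ncard = 2 * (t + 1) := by
  rw [← card_perp ht u, ← Nat.card_coe_set_eq, ← Nat.card_eq_fintype_card]
  rfl

theorem eq_add_of_adj (ht : t = 1 ∨ t = 2 ∨ t = 4) {u v w : {u : Coord t // IsPoint u}}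
    (huv : (graph t).Adj u v) (huw : (graph t).Adj u w) (hvw : (graph t).Adj v w) :
    w.1 = u.1 + v.1 := by
  rcases eq_or_eq_or_eq_add ht u v huv.1 huv.2 w huw.2 hvw.2 with h | h | h
  · exact absurd (Subtype.ext h.symm) huw.1
  · exact absurd (Subtype.ext h.symm) hvw.1
  · exact h

theorem isQuadrangle_graph (ht : t = 1 ∨ t = 2 ∨ t = 4) : IsQuadrangle (graph t) where
  exists_third {u v} h := by
    refine ⟨⟨u.1 + v.1, u.2.add ht v.2 (fun e => h.1 (Subtype.ext e)) h.2⟩,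
      ⟨fun e => v.2.1 ?_, ?_⟩, ⟨fun e => u.2.1 ?_, ?_⟩⟩
    · simpa using congrArg Subtype.val e
    · simp [form_add_right, form_self, h.2]
    · simpa using congrArg Subtype.val e
    · change form v.1 (u.1 + v.1) = 0
      rw [form_add_right, form_self, form_comm, h.2, add_zero]
  third_unique hab hac hbc had hbd :=
    Subtype.ext ((eq_add_of_adj ht hab hac hbc).trans (eq_add_of_adj ht hab had hbd).symm)
  exists_adj {a b c} hab hac hbc w ha hb hc := by
    have hw : form w.1 c.1 = form w.1 a.1 + form w.1 b.1 := by
      rw [eq_add_of_adj ht hab hac hbc, form_add_right]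
    by_contra! hcon
    have h1 : ∀ s : ZMod 2, s ≠ 0 → s = 1 := by decide
    have ha' := h1 _ fun h => hcon.1 ⟨ha, h⟩
    have hb' := h1 _ fun h => hcon.2.1 ⟨hb, h⟩
    have hc' := h1 _ fun h => hcon.2.2 ⟨hc, h⟩
    rw [ha', hb', hc'] at hw
    exact absurd hw (by decide)

end Coord

/-! ### The coordinates of a point with respect to a frame -/

open Classical in
/-- The indicator, with values in `ZMod 2`, of the pairs of distinct nonadjacent vertices. -/
noncomputable def far {X : Type*} (Γ : SimpleGraph X) (a b : X) : ZMod 2 :=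
  if a = b ∨ Γ.Adj a b then 0 else 1

section far

variable {X : Type*} {Γ : SimpleGraph X}

theorem far_eq_zero {a b : X} : far Γ a b = 0 ↔ a = b ∨ Γ.Adj a b := by
  simp [far, imp_iff_not_or]

theorem far_self (a : X) : far Γ a a = 0 := far_eq_zero.2 (.inl rfl)

theorem far_comm (a b : X) : far Γ a b = far Γ b a := by
  classical
  exact if_congr (or_congr eq_comm (Γ.adj_comm a b)) rfl rfl

/-- On a line, `far Γ w` takes the value `1` at none or at two of the three points. -/
theorem IsQuadrangle.far_third (h : IsQuadrangle Γ) {a b c : X} (hab : Γ.Adj a b)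
    (hac : Γ.Adj a c) (hbc : Γ.Adj b c) (w : X) : far Γ w c = far Γ w a + far Γ w b := by
  by_cases ha : w = a
  · subst ha; simp [far, hab, hac]
  by_cases hb : w = b
  · subst hb; simp [far, hab.symm, hbc]
  by_cases hc : w = c
  · subst hc; simp [far, hac.symm, hbc.symm]
  have h1 : ¬ (Γ.Adj w a ∧ Γ.Adj w b) := fun hh => hc
    (h.third_unique hab hh.1.symm hh.2.symm hac hbc)
  have h2 : ¬ (Γ.Adj w a ∧ Γ.Adj w c) := fun hh => hb
    (h.third_unique hac hh.1.symm hh.2.symm hab hbc.symm)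
  have h3 : ¬ (Γ.Adj w b ∧ Γ.Adj w c) := fun hh => ha
    (h.third_unique hbc hh.1.symm hh.2.symm hab.symm hac.symm)
  have h4 := h.exists_adj hab hac hbc ha hb hc
  have h5 : (1 : ZMod 2) + 1 = 0 := rfl
  simp only [far, ha, hb, hc, false_or]
  split_ifs <;> simp_all

end far

/-- The coordinates of `w`: the values of `far Γ w` at the points `x`, `y`, `p i` of a frame. -/
noncomputable def coord {X : Type*} (Γ : SimpleGraph X) {t : ℕ} (x y : X) (p : Fin (t + 1) → X)
    (w : X) : Coord t :=
  (far Γ w x, far Γ w y, fun i => far Γ w (p i))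

namespace IsFrame

variable {X : Type*} {Γ : SimpleGraph X} {t : ℕ} {x y : X} {p p' q : Fin (t + 1) → X}

theorem coord_third (h : IsQuadrangle Γ) {a b c : X} (hab : Γ.Adj a b)
    (hac : Γ.Adj a c) (hbc : Γ.Adj b c) :
    coord Γ x y p c = coord Γ x y p a + coord Γ x y p b := by
  ext <;> simp [coord, far_comm c, far_comm a, far_comm b, h.far_third hab hac hbc]

theorem coord_left (F : IsFrame Γ x y p p' q) : coord Γ x y p x = (0, 1, 0) := by
  ext <;> simp [coord, far, F.ne, F.not_adj, F.adj_left]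

theorem coord_right (F : IsFrame Γ x y p p' q) : coord Γ x y p y = (1, 0, 0) := by
  ext <;> simp [coord, far, F.ne.symm, Γ.adj_comm y x, F.not_adj, F.adj_right]

theorem coord_p (F : IsFrame Γ x y p p' q) (h : IsQuadrangle Γ) (j : Fin (t + 1)) :
    coord Γ x y p (p j) = (0, 0, fun i => 1 - Pi.single j 1 i) := by
  ext i
  · simp [coord, far, (F.adj_left j).symm]
  · simp [coord, far, (F.adj_right j).symm]
  · by_cases hij : i = j
    · subst hij; simp [coord, far_self]
    · simp [coord, far, hij, F.not_adj_p_p h, F.injective.eq_iff, Ne.symm hij]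

/-- For even `t` the coordinate vectors of the points do not span the whole space. -/
theorem sum_coord (F : IsFrame Γ x y p p' q) (h : IsQuadrangle Γ) (ht : 1 ≤ t) (he : Even t)
    (w : X) : ∑ i, (coord Γ x y p w).2.2 i = 0 := by
  have : Nontrivial (Fin (t + 1)) := Fin.nontrivial_iff_two_le.2 (by lia)
  have he' : (t : ZMod 2) = 0 := (ZMod.natCast_eq_zero_iff_even).2 he
  refine F.induction h (P := fun w => ∑ i, (coord Γ x y p w).2.2 i = 0) ?_ ?_ (fun j => ?_)
    (fun a b c hab hac hbc ha hb => ?_) w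
  · simp [F.coord_left]
  · simp [F.coord_right]
  · simp [F.coord_p h, he']
  · simp [coord_third h hab hac hbc, Finset.sum_add_distrib, ha, hb]

/-- Both sides are additive along lines in `b`, so it suffices to compare them when `b` is one of
the generators `x`, `y`, `p j`. -/
theorem far_eq_form (F : IsFrame Γ x y p p' q) (h : IsQuadrangle Γ) (ht : 1 ≤ t) (a b : X) :
    far Γ a b = Coord.form (coord Γ x y p a) (coord Γ x y p b) := by
  have : Nontrivial (Fin (t + 1)) := Fin.nontrivial_iff_two_le.2 (by lia)
  have hs : ((t : ZMod 2) + 1) * ∑ i, far Γ a (p i) = 0 := by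
    rcases Nat.even_or_odd t with he | ho
    · rw [show ∑ i, far Γ a (p i) = 0 from F.sum_coord h ht he a, mul_zero]
    · rw [ZMod.natCast_eq_one_iff_odd.2 ho]
      exact zero_mul _
  refine F.induction h
    (P := fun b => far Γ a b = Coord.form (coord Γ x y p a) (coord Γ x y p b)) ?_ ?_ (fun j => ?_)
    (fun b c d hbc hbd hcd hb hc => ?_) b
  · rw [F.coord_left]
    simp [Coord.form, coord]
  · rw [F.coord_right]
    simp [Coord.form, coord]
  · rw [F.coord_p h]
    simp [Coord.form, coord, mul_sub, Pi.single_apply]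
    rw [← sub_eq_zero, ← hs]
    have h2 : (2 : ZMod 2) = 0 := rfl
    linear_combination (far Γ a (p j) - (t + 1) * ∑ i, far Γ a (p i)) * h2
  · rw [coord_third h hbc hbd hcd, Coord.form_add_right, ← hb, ← hc, h.far_third hbc hbd hcd]

theorem quad_coord (F : IsFrame Γ x y p p' q) (h : IsQuadrangle Γ) (ht : t = 1 ∨ t = 4) (w : X) :
    Coord.quad (coord Γ x y p w) = 0 := by
  have : Nontrivial (Fin (t + 1)) := Fin.nontrivial_iff_two_le.2 (by lia)
  refine F.induction h (P := fun w => Coord.quad (coord Γ x y p w) = 0) ?_ ?_ (fun j => ?_)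
    (fun a b c hab hac hbc ha hb => ?_) w
  · simp [F.coord_left, Coord.quad]
  · simp [F.coord_right, Coord.quad]
  · rw [F.coord_p h]
    rcases ht with rfl | rfl <;> revert j <;> decide
  · rw [coord_third h hab hac hbc, Coord.quad_add ht, ← F.far_eq_form h (by lia), ha, hb,
      far_eq_zero.2 (.inr hab)]
    rfl

theorem coord_ne_zero (F : IsFrame Γ x y p p' q) (h : IsQuadrangle Γ) (ht : 1 ≤ t) (w : X) :
    coord Γ x y p w ≠ 0 := by
  have : Nontrivial (Fin (t + 1)) := Fin.nontrivial_iff_two_le.2 (by lia)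
  intro h0
  have hx : far Γ w x = 0 := congrArg Prod.fst h0
  have hy : far Γ w y = 0 := congrArg (fun u => u.2.1) h0
  have hp i : far Γ w (p i) = 0 := congrArg (fun u => u.2.2 i) h0
  rw [far_eq_zero] at hx hy
  rcases hx with rfl | hx
  · exact hy.elim F.ne F.not_adj
  rcases hy with rfl | hy
  · exact F.not_adj hx.symm
  obtain ⟨j, rfl⟩ := F.complete hx.symm hy.symm
  obtain ⟨i, hij⟩ := exists_ne j
  exact (far_eq_zero.1 (hp i)).elim (fun e => hij (F.injective e).symm) (F.not_adj_p_p h _ _)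

theorem coord_injective (F : IsFrame Γ x y p p' q) (h : IsQuadrangle Γ) (ht : 1 ≤ t) :
    Function.Injective (coord Γ x y p) := by
  intro a b hab
  by_contra hne
  have hadj : Γ.Adj a b := by
    refine (far_eq_zero.1 ?_).resolve_left hne
    rw [F.far_eq_form h ht, hab, Coord.form_self]
  obtain ⟨c, hac, hbc⟩ := h.exists_third hadj
  refine F.coord_ne_zero h ht c ?_
  rw [coord_third h hadj hac hbc, hab, Coord.add_self]

theorem nonempty_iso [Fintype X] (F : IsFrame Γ x y p p' q) (h : IsQuadrangle Γ)
    (ht : t = 1 ∨ t = 2 ∨ t = 4) (hdeg : ∀ x, (Γ.neighborSet x).ncard = 2 * (t + 1)) :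
    Nonempty (Γ ≃g Coord.graph t) := by
  have ht1 : 1 ≤ t := by lia
  have : Nonempty X := ⟨x⟩
  let f (w : X) : {u : Coord t // Coord.IsPoint u} := ⟨coord Γ x y p w, F.coord_ne_zero h ht1 w,
    fun he => F.sum_coord h ht1 he w, fun h2 => F.quad_coord h (by lia) w⟩
  have hf : Function.Injective f := fun a b hab =>
    F.coord_injective h ht1 (congrArg Subtype.val hab)
  have hbij : Function.Bijective f := (Fintype.bijective_iff_injective_and_card f).2
    ⟨hf, by rw [h.card_eq hdeg, Coord.card_isPoint ht]⟩
  refine ⟨⟨Equiv.ofBijective f hbij, fun {a b} => ?_⟩⟩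
  change f a ≠ f b ∧ Coord.form (coord Γ x y p a) (coord Γ x y p b) = 0 ↔ _
  rw [← F.far_eq_form h ht1, hf.ne_iff, far_eq_zero]
  exact ⟨fun h => h.2.resolve_left h.1, fun h => ⟨h.ne, .inr h⟩⟩

end IsFrame

theorem IsQuadrangle.nonempty_iso {X : Type*} {Γ : SimpleGraph X} [Fintype X] [Nonempty X]
    (h : IsQuadrangle Γ) {t : ℕ} (ht : 1 ≤ t)
    (hdeg : ∀ x, (Γ.neighborSet x).ncard = 2 * (t + 1)) :
    (t = 1 ∨ t = 2 ∨ t = 4) ∧ Nonempty (Γ ≃g Coord.graph t) := by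
  obtain ⟨x⟩ := ‹Nonempty X›
  have : Nonempty X := ⟨x⟩
  obtain ⟨y, hne, hxy⟩ := h.exists_not_adj ht hdeg x
  obtain ⟨p, p', q, F⟩ := h.exists_isFrame_fin hdeg hne hxy
  exact ⟨F.order_mem ht h, F.nonempty_iso h (F.order_mem ht h) hdeg⟩

/-! ### Regular near 4-gons -/

section

variable {X : Type*} {Γ : SimpleGraph X}

theorem HasIntersectionNumbers.ncard_neighborSet {a b c : ℕ → ℕ}
    (H : HasIntersectionNumbers Γ a b c) (x : X) : (Γ.neighborSet x).ncard = b 0 := by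
  rw [← Γ.dist_self (v := x), ← H.b_eq x x]
  congr 1
  ext z
  simp +contextual [SimpleGraph.neighborSet, SimpleGraph.dist_comm, SimpleGraph.dist_eq_one_iff_adj]

theorem HasIntersectionNumbers.ncard_commonNeighbors {a b c : ℕ → ℕ}
    (H : HasIntersectionNumbers Γ a b c) {x y : X} (h : Γ.Adj x y) :
    {z | Γ.Adj x z ∧ Γ.Adj y z}.ncard = a 1 := by
  rw [← SimpleGraph.dist_eq_one_iff_adj.2 h, ← H.a_eq x y]
  simp [SimpleGraph.dist_eq_one_iff_adj.2 h, SimpleGraph.dist_eq_one_iff_adj, Γ.adj_comm y]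

theorem dist_eq_two (hconn : Γ.Connected) (hdist : ∀ x y, Γ.dist x y ≤ 2) {x y : X} :
    Γ.dist x y = 2 ↔ x ≠ y ∧ ¬ Γ.Adj x y := by
  rw [Ne, ← hconn.dist_eq_zero_iff, ← SimpleGraph.dist_eq_one_iff_adj]
  have := hdist x y
  lia

theorem dist_le_two [Finite X] (hdiam : Γ.diam = 2) (x y : X) : Γ.dist x y ≤ 2 := by
  rw [← hdiam]
  exact SimpleGraph.dist_le_diam (SimpleGraph.ediam_ne_top_of_diam_ne_zero (by lia))

theorem exists_dist_eq_two [Nonempty X] (hdiam : Γ.diam = 2) : ∃ x y, Γ.dist x y = 2 := by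
  obtain ⟨x, y, h⟩ := Γ.exists_dist_eq_diam
  exact ⟨x, y, h.trans hdiam⟩

/-- From `a 1 = 1`, two adjacent vertices have one common neighbour. If `w` is at distance 2 from a
vertex `x`, then `a 2 = c 2` says that `w` is adjacent to half of the neighbours of `x`; it is
adjacent to at most one point other than `x` on each line through `x`, hence to exactly one. -/
theorem IsRegularNearPolygon.isQuadrangle [Finite X] (h : IsRegularNearPolygon Γ 2) {t : ℕ}
    (ho : HasOrder Γ 2 t) :
    IsQuadrangle Γ ∧ ∀ x, (Γ.neighborSet x).ncard = 2 * (t + 1) := by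
  obtain ⟨a, b, c, H, ha, hb⟩ := ho
  have ha1 : a 1 = 1 := by lia
  have hdeg (x : X) : (Γ.neighborSet x).ncard = 2 * (t + 1) := by
    rw [H.ncard_neighborSet, ← hb, ha1]
    lia
  have hconn := h.distanceRegular.1
  have hdist := dist_le_two h.diam_eq
  have third {x y : X} (hxy : Γ.Adj x y) : ∃ z, Γ.Adj x z ∧ Γ.Adj y z := by
    have := H.ncard_commonNeighbors hxy
    rw [ha1] at this
    exact Set.nonempty_of_ncard_ne_zero (s := {z | Γ.Adj x z ∧ Γ.Adj y z}) (by lia)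
  have unique {x y z w : X} (hxy : Γ.Adj x y) (hxz : Γ.Adj x z) (hyz : Γ.Adj y z)
      (hxw : Γ.Adj x w) (hyw : Γ.Adj y w) : z = w := by
    have := H.ncard_commonNeighbors hxy
    rw [ha1, Set.ncard_eq_one] at this
    obtain ⟨v, hv⟩ := this
    have hz : z ∈ ({v} : Set X) := hv ▸ ⟨hxz, hyz⟩
    have hw : w ∈ ({v} : Set X) := hv ▸ ⟨hxw, hyw⟩
    exact hz.trans hw.symm
  refine ⟨⟨third, unique, fun {x y z} hxy hxz hyz w hwx hwy hwz => ?_⟩, hdeg⟩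
  by_contra! hcon
  have hd : Γ.dist w x = 2 := (dist_eq_two hconn hdist).2 ⟨hwx, hcon.1⟩
  set C := {v | Γ.Adj w v ∧ Γ.Adj x v} with hC
  have hc : C.ncard = c 2 := by
    rw [← hd, ← H.c_eq w x]
    simp [hC, hd, SimpleGraph.dist_eq_one_iff_adj, Γ.adj_comm x]
  have hac : a 2 = c 2 := by
    rw [h.a_eq_mul a b c H 2 (by lia) le_rfl, ha1, one_mul]
  have hCcard : 2 * C.ncard = 2 * (t + 1) := by
    rw [← hdeg w, two_mul]
    nth_rw 2 [hc]
    rw [← hac, ← hd, ← H.a_eq w x, ← Set.ncard_union_eq]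
    · congr 1
      ext v
      simp only [hC, Set.mem_union, Set.mem_ofPred_eq, SimpleGraph.mem_neighborSet, ← and_or_left,
        and_iff_left_iff_imp, hd]
      intro hv
      rw [← SimpleGraph.dist_eq_one_iff_adj, Γ.dist_comm]
      have h0 : Γ.dist v x ≠ 0 := by
        rw [Ne, hconn.dist_eq_zero_iff]
        rintro rfl
        exact hcon.1 hv
      have := hdist v x
      lia
    · rw [Set.disjoint_left]
      rintro v ⟨-, hv⟩ ⟨-, hv'⟩
      rw [hd, (SimpleGraph.dist_eq_one_iff_adj).2 hv.symm] at hv'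
      lia
  choose! τ hτ using fun v (hv : Γ.Adj x v) => third hv
  have hinv {v : X} (hv : Γ.Adj x v) : τ (τ v) = v :=
    unique (hτ v hv).1 (hτ _ (hτ v hv).1).1 (hτ _ (hτ v hv).1).2 hv (hτ v hv).2.symm
  have hτC : (τ '' C).ncard = C.ncard := Set.InjOn.ncard_image fun u hu v hv huv => by
    rw [← hinv hu.2, ← hinv hv.2, huv]
  have hdisj : Disjoint C (τ '' C) := by
    rw [Set.disjoint_left]
    rintro _ ⟨h1, -⟩ ⟨v, hv, rfl⟩
    exact hwx (unique (hτ v hv.2).2 hv.1.symm h1.symm hv.2.symm (hτ v hv.2).1.symm)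
  have hunion : C ∪ τ '' C = Γ.neighborSet x := by
    refine Set.eq_of_subset_of_ncard_le ?_ ?_
    · rintro v (hv | ⟨v, hv, rfl⟩)
      exacts [hv.2, (hτ v hv.2).1]
    · rw [Set.ncard_union_eq hdisj, hτC, hdeg]
      lia
  have hy : y ∈ C ∪ τ '' C := hunion ▸ hxy
  rcases hy with hy | ⟨v, hv, rfl⟩
  · exact hcon.2.1 hy.1
  · rw [unique hxy hxz hyz hv.2 (hτ v hv.2).2.symm] at hcon
    exact hcon.2.2 hv.1

theorem IsQuadrangle.ncard_commonNeighbors_eq (h : IsQuadrangle Γ) [Finite X] {t : ℕ}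
    (hdeg : ∀ x, (Γ.neighborSet x).ncard = 2 * (t + 1)) {x y : X} (hne : x ≠ y)
    (hxy : ¬ Γ.Adj x y) : {w | Γ.Adj x w ∧ Γ.Adj y w}.ncard = t + 1 := by
  have := h.ncard_neighborSet_eq hne hxy
  rw [hdeg] at this
  lia

theorem IsQuadrangle.exists_walk_length_eq_two (h : IsQuadrangle Γ) [Finite X] {t : ℕ}
    (hdeg : ∀ x, (Γ.neighborSet x).ncard = 2 * (t + 1)) {x y : X} (hne : x ≠ y)
    (hxy : ¬ Γ.Adj x y) : ∃ p : Γ.Walk x y, p.length = 2 := by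
  obtain ⟨w, hw⟩ := Set.nonempty_of_ncard_ne_zero (s := {w | Γ.Adj x w ∧ Γ.Adj y w})
    (by rw [h.ncard_commonNeighbors_eq hdeg hne hxy]; lia)
  exact ⟨.cons hw.1 (.cons hw.2.symm .nil), rfl⟩

theorem IsQuadrangle.dist_eq_two_of_not_adj (h : IsQuadrangle Γ) [Finite X] {t : ℕ}
    (hdeg : ∀ x, (Γ.neighborSet x).ncard = 2 * (t + 1)) {x y : X} (hne : x ≠ y)
    (hxy : ¬ Γ.Adj x y) : Γ.dist x y = 2 := by
  obtain ⟨p, hp⟩ := h.exists_walk_length_eq_two hdeg hne hxy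
  have h2 := hp ▸ SimpleGraph.dist_le p
  have h1 : Γ.dist x y ≠ 1 := by rwa [Ne, SimpleGraph.dist_eq_one_iff_adj]
  have h0 := p.reachable.pos_dist_of_ne hne
  lia

theorem IsQuadrangle.connected (h : IsQuadrangle Γ) [Finite X] [Nonempty X] {t : ℕ}
    (hdeg : ∀ x, (Γ.neighborSet x).ncard = 2 * (t + 1)) : Γ.Connected := by
  refine ⟨fun x y => ?_⟩
  by_cases hne : x = y
  · exact hne ▸ .refl _
  by_cases hxy : Γ.Adj x y
  · exact hxy.reachable
  obtain ⟨p, -⟩ := h.exists_walk_length_eq_two hdeg hne hxy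
  exact p.reachable

theorem IsQuadrangle.dist_le_two (h : IsQuadrangle Γ) [Finite X] {t : ℕ}
    (hdeg : ∀ x, (Γ.neighborSet x).ncard = 2 * (t + 1)) (x y : X) : Γ.dist x y ≤ 2 := by
  by_cases hne : x = y
  · simp [hne]
  by_cases hxy : Γ.Adj x y
  · simp [SimpleGraph.dist_eq_one_iff_adj.2 hxy]
  · exact (h.dist_eq_two_of_not_adj hdeg hne hxy).le

theorem IsQuadrangle.hasIntersectionNumbers (h : IsQuadrangle Γ) [Finite X] [Nonempty X] {t : ℕ}
    (hdeg : ∀ x, (Γ.neighborSet x).ncard = 2 * (t + 1)) :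
    HasIntersectionNumbers Γ (fun i => if i = 0 then 0 else if i = 1 then 1 else t + 1)
      (fun i => if i = 0 then 2 * (t + 1) else if i = 1 then 2 * t else 0)
      (fun i => if i = 0 then 0 else if i = 1 then 1 else t + 1) := by
  have hconn := h.connected hdeg
  have hdist := h.dist_le_two hdeg
  have two {x y : X} : Γ.dist x y = 2 ↔ x ≠ y ∧ ¬ Γ.Adj x y := dist_eq_two hconn hdist
  have one {x y : X} : Γ.dist x y = 1 ↔ Γ.Adj x y := SimpleGraph.dist_eq_one_iff_adj
  have zero {x y : X} : Γ.dist x y = 0 ↔ x = y := hconn.dist_eq_zero_iff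
  have hcases (x y : X) : x = y ∨ Γ.Adj x y ∨ Γ.dist x y = 2 := by
    rw [two]
    tauto
  refine ⟨fun x y => ?_, fun x y => ?_, fun x y => ?_⟩
  · rcases hcases x y with rfl | hxy | hxy
    · simp only [SimpleGraph.dist_self, zero_add, one, if_true]
      rw [← hdeg x]
      congr 1
      ext z
      simp +contextual [Γ.adj_comm]
    · obtain ⟨c, hxc, hyc⟩ := h.exists_third hxy
      have hset : {z | Γ.Adj x z ∧ z ≠ y ∧ ¬ Γ.Adj z y} = Γ.neighborSet x \ {y, c} := by
        ext z
        simp only [Set.mem_ofPred_eq, Set.mem_sdiff, SimpleGraph.mem_neighborSet,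
          Set.mem_insert_iff, Set.mem_singleton_iff, not_or]
        refine and_congr_right fun hz => and_congr_right fun _ => not_congr ⟨fun hzy => ?_, ?_⟩
        · exact h.third_unique hxy hz hzy.symm hxc hyc
        · rintro rfl
          exact hyc.symm
      simp only [one.2 hxy, one_add_one_eq_two, two, hset]
      rw [Set.ncard_sdiff (by rintro z (rfl | rfl) <;> assumption), Set.ncard_pair hyc.ne, hdeg]
      simp
      lia
    · have : {z | Γ.Adj x z ∧ Γ.dist z y = 2 + 1} = ∅ := by
        ext z
        have := hdist z y
        simp only [Set.mem_ofPred_eq, Set.mem_empty_iff_false, iff_false]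
        lia
      simp [hxy, this]
  · rcases hcases x y with rfl | hxy | hxy
    · have : {z | Γ.Adj x z ∧ z = x} = ∅ := by
        ext z
        simp only [Set.mem_ofPred_eq, Set.mem_empty_iff_false, iff_false]
        rintro ⟨h, rfl⟩
        exact h.ne rfl
      simp [zero, this]
    · obtain ⟨c, hxc, hyc⟩ := h.exists_third hxy
      have hset : {z | Γ.Adj x z ∧ Γ.Adj z y} = {c} := by
        ext z
        simp only [Set.mem_ofPred_eq, Set.mem_singleton_iff]
        refine ⟨fun hz => h.third_unique hxy hz.1 hz.2.symm hxc hyc, ?_⟩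
        rintro rfl
        exact ⟨hxc, hyc.symm⟩
      simp [one.2 hxy, one, hset]
    · have hset : {z | Γ.Adj x z ∧ z ≠ y ∧ ¬ Γ.Adj z y} =
          Γ.neighborSet x \ {z | Γ.Adj x z ∧ Γ.Adj y z} := by
        ext z
        simp only [Set.mem_ofPred_eq, Set.mem_sdiff, SimpleGraph.mem_neighborSet, not_and,
          Γ.adj_comm y]
        refine and_congr_right fun hz => ?_
        refine ⟨fun hzy _ => hzy.2, fun hzy => ⟨?_, hzy hz⟩⟩
        rintro rfl
        exact (two.1 hxy).2 hz
      simp only [hxy, two, hset]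
      rw [Set.ncard_sdiff (fun z hz => hz.1), hdeg,
        h.ncard_commonNeighbors_eq hdeg (two.1 hxy).1 (two.1 hxy).2]
      simp
      lia
  · rcases hcases x y with rfl | hxy | hxy
    · simp
    · have : {z | Γ.Adj x z ∧ z = y} = {y} := by
        ext z
        simp only [Set.mem_ofPred_eq, Set.mem_singleton_iff, and_iff_right_iff_imp]
        rintro rfl
        exact hxy
      simp [one.2 hxy, zero, this]
    · simp only [hxy, Nat.reduceEqDiff, one, Γ.adj_comm _ y]
      rw [h.ncard_commonNeighbors_eq hdeg (two.1 hxy).1 (two.1 hxy).2]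
      simp

theorem IsQuadrangle.isRegularNearPolygon (h : IsQuadrangle Γ) [Finite X] [Nonempty X] {t : ℕ}
    (ht : 1 ≤ t) (hdeg : ∀ x, (Γ.neighborSet x).ncard = 2 * (t + 1)) :
    IsRegularNearPolygon Γ 2 ∧ HasOrder Γ 2 t := by
  have H := h.hasIntersectionNumbers hdeg
  have hconn := h.connected hdeg
  obtain ⟨x⟩ := ‹Nonempty X›
  have : Nonempty X := ⟨x⟩
  obtain ⟨y, hne, hxy⟩ := h.exists_not_adj ht hdeg x
  have hd := h.dist_eq_two_of_not_adj hdeg hne hxy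
  obtain ⟨z, hxz, -⟩ := Set.nonempty_of_ncard_ne_zero (s := {w | Γ.Adj x w ∧ Γ.Adj y w})
    (by rw [h.ncard_commonNeighbors_eq hdeg hne hxy]; lia)
  have hz : Γ.dist x z = 1 := SimpleGraph.dist_eq_one_iff_adj.2 hxz
  refine ⟨⟨⟨hconn, _, _, _, H⟩, ?_, le_rfl, ?_, ?_⟩, _, _, _, H, rfl, ?_⟩
  · obtain ⟨u, v, huv⟩ := Γ.exists_dist_eq_diam
    refine le_antisymm (huv ▸ h.dist_le_two hdeg u v) (hd ▸ SimpleGraph.dist_le_diam ?_)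
    exact SimpleGraph.connected_iff_ediam_ne_top.1 hconn
  · intro x u v huv hne
    -- A point of the local graph has only one neighbour there.
    obtain ⟨p⟩ := huv
    suffices u = v ∨ (Γ.induce (Γ.neighborSet x)).Adj u v from this.resolve_left hne
    clear hne
    induction p with
    | nil => exact .inl rfl
    | @cons u v w huv p ih =>
      rcases ih with rfl | hvw
      · exact .inr huv
      · left
        exact Subtype.ext (h.third_unique v.2 u.2 huv.symm w.2 hvw)
  · intro a b c H' i hi1 hi2
    have h1 : a 1 = 1 := by
      rw [← hz, ← H'.a_eq x z, H.a_eq x z, hz]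
      simp
    obtain rfl | rfl : i = 1 ∨ i = 2 := by lia
    · have h2 : c 1 = 1 := by
        rw [← hz, ← H'.c_eq x z, H.c_eq x z, hz]
        simp
      rw [h1, h2]
    · rw [h1, one_mul, ← hd, ← H'.c_eq x y, ← H'.a_eq x y, H.c_eq x y, H.a_eq x y]
  · simp [mul_comm]

end

/-! ### The idempotent of a dependent triangle -/

theorem adjMatrix_mul_self_apply {X : Type*} [Fintype X] (Γ : SimpleGraph X)
    [DecidableRel Γ.Adj] (x y : X) :
    (Γ.adjMatrix ℝ * Γ.adjMatrix ℝ) x y = ({z | Γ.Adj x z ∧ Γ.Adj z y}.ncard : ℝ) := by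
  rw [SimpleGraph.adjMatrix_mul_apply, Set.ncard_eq_toFinset_card']
  simp only [SimpleGraph.adjMatrix_apply, Finset.sum_boole]
  congr 2
  ext z
  simp

section

variable {X : Type*} [Fintype X] [DecidableEq X] {Γ : SimpleGraph X} [DecidableRel Γ.Adj]

/-- In diameter 2 the Bose-Mesner algebra is spanned by the identity, the adjacency matrix and
the all-one matrix. -/
theorem HasIntersectionNumbers.exists_eq_of_mem_boseMesner {a b c : ℕ → ℕ}
    (H : HasIntersectionNumbers Γ a b c) (hconn : Γ.Connected) (hdist : ∀ x y, Γ.dist x y ≤ 2)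
    {M : Matrix X X ℝ} (hM : M ∈ boseMesner Γ) :
    ∃ α β γ : ℝ, M = α • 1 + β • Γ.adjMatrix ℝ + γ • Matrix.of fun _ _ => 1 := by
  set A := Γ.adjMatrix ℝ with hA
  set J : Matrix X X ℝ := Matrix.of fun _ _ => 1 with hJ
  have hdeg (x : X) : ∑ y, A x y = b 0 := by
    rw [← H.ncard_neighborSet x, Set.ncard_eq_toFinset_card']
    simp [hA, SimpleGraph.adjMatrix_apply]
  have hAJ : A * J = (b 0 : ℝ) • J := by
    ext x y
    simp [Matrix.mul_apply, hJ, hdeg]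
  have hJA : J * A = (b 0 : ℝ) • J := by
    ext x y
    have (z : X) : A z y = A y z := by simp [hA, SimpleGraph.adjMatrix_apply, Γ.adj_comm]
    simp [Matrix.mul_apply, hJ, hdeg, this]
  have hJJ : J * J = (Fintype.card X : ℝ) • J := by
    ext x y
    simp [Matrix.mul_apply, hJ]
  have hAA : A * A = ((b 0 : ℝ) - c 2) • 1 + ((a 1 : ℝ) - c 2) • A + (c 2 : ℝ) • J := by
    ext x y
    rw [adjMatrix_mul_self_apply]
    by_cases hxy : x = y
    · subst hxy
      rw [← H.ncard_neighborSet x]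
      simp [hA, hJ, Γ.adj_comm _ x, SimpleGraph.neighborSet]
    by_cases hadj : Γ.Adj x y
    · rw [← H.ncard_commonNeighbors hadj]
      simp [hA, hJ, hadj, hxy, Γ.adj_comm _ y]
    · have hd := (dist_eq_two hconn hdist).2 ⟨hxy, hadj⟩
      rw [← hd, ← H.c_eq x y, hd]
      simp [hA, hJ, hadj, hxy, SimpleGraph.dist_eq_one_iff_adj]
  induction hM using Algebra.adjoin_induction with
  | mem x hx =>
    rw [Set.mem_singleton_iff] at hx
    exact ⟨0, 1, 0, by simp [hx, hA]⟩
  | algebraMap r => exact ⟨r, 0, 0, by simp [Algebra.algebraMap_eq_smul_one]⟩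
  | add x y _ _ hx hy =>
    obtain ⟨α, β, γ, rfl⟩ := hx
    obtain ⟨α', β', γ', rfl⟩ := hy
    exact ⟨α + α', β + β', γ + γ', by module⟩
  | mul x y _ _ hx hy =>
    obtain ⟨α, β, γ, rfl⟩ := hx
    obtain ⟨α', β', γ', rfl⟩ := hy
    refine ⟨α * α' + β * β' * (b 0 - c 2), α * β' + β * α' + β * β' * (a 1 - c 2),
      α * γ' + γ * α' + β * β' * c 2 + β * γ' * b 0 + γ * β' * b 0 +
        γ * γ' * Fintype.card X, ?_⟩
    simp only [add_mul, mul_add, smul_mul_assoc, mul_smul_comm, one_mul, mul_one, hAA, hAJ, hJA,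
      hJJ]
    module

/-- The entries `e0`, `e1`, `e2` of a `Q`-polynomial idempotent at distance 0, 1, 2. The last
clause says that the matrix is the Gram matrix of its rows. -/
theorem IsQPolynomial.exists_entries (hΓ : IsDistanceRegular Γ) (hdiam : Γ.diam = 2)
    {E : Matrix X X ℝ} (hE : IsQPolynomial Γ 2 E) :
    ∃ e0 e1 e2 : ℝ, (e0 ≠ 0 ∧ e0 ≠ e1 ∧ e0 ≠ e2) ∧ (∀ u, E u u = e0) ∧
      (∀ u v, Γ.Adj u v → E u v = e1) ∧ (∀ u v, u ≠ v → ¬ Γ.Adj u v → E u v = e2) ∧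
      ∀ u v, ∑ w, E u w * E v w = E u v := by
  obtain ⟨hconn, a, b, c, H⟩ := hΓ
  have : Nonempty X := hconn.nonempty
  have hdist := dist_le_two hdiam
  obtain ⟨F, ⟨hF, q, hq, hqF⟩, rfl⟩ := hE
  have hmem : F 1 ∈ boseMesner Γ := by
    rw [← Subalgebra.mem_toSubmodule, ← hF.span_eq]
    exact Submodule.subset_span ⟨1, rfl⟩
  obtain ⟨α, β, e2, hαβ⟩ := H.exists_eq_of_mem_boseMesner hconn hdist hmem
  obtain ⟨e0, rfl⟩ : ∃ e0, α = e0 - e2 := ⟨α + e2, by ring⟩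
  obtain ⟨e1, rfl⟩ : ∃ e1, β = e1 - e2 := ⟨β + e2, by ring⟩
  set E := F 1 with hEdef
  have E0 (u : X) : E u u = e0 := by simp [hαβ]
  have E1 {u v : X} (h : Γ.Adj u v) : E u v = e1 := by simp [hαβ, h, h.ne]
  have E2 {u v : X} (hne : u ≠ v) (h : ¬ Γ.Adj u v) : E u v = e2 := by simp [hαβ, h, hne]
  have hsymm (u v : X) : E u v = E v u := by
    simp [hαβ, Matrix.one_apply, SimpleGraph.adjMatrix_apply, Γ.adj_comm, eq_comm]
  have hn : (Fintype.card X : ℝ) ≠ 0 := by exact_mod_cast Fintype.card_ne_zero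
  have hsq (u v : X) : ∑ w, E u w * E v w = E u v := by
    have := congrFun₂ (hF.mul_eq 1 1) u v
    rw [if_pos rfl, Matrix.mul_apply] at this
    exact (Finset.sum_congr rfl fun w _ => by rw [hsymm v w]).trans this
  have hrow (u : X) : ∑ w, E u w = 0 := by
    have := congrFun₂ (hF.mul_eq 1 0) u u
    rw [if_neg (by decide), hF.trivial_eq, Matrix.mul_smul] at this
    simpa [Matrix.mul_apply, hn] using this
  have hE0 : E ≠ 0 := hF.linearIndependent.ne_zero 1
  have he0 : e0 ≠ 0 := by
    rintro rfl
    refine hE0 (Matrix.ext fun u v => ?_)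
    have := hsq u u
    rw [E0, Finset.sum_eq_zero_iff_of_nonneg fun _ _ => mul_self_nonneg _] at this
    exact mul_self_eq_zero.1 (this v (Finset.mem_univ v))
  -- If `e0 = e1` then adjacent vertices have the same row, so all rows agree.
  have he01 : e0 ≠ e1 := by
    intro he
    have hrows {u v : X} (huv : Γ.Adj u v) (w : X) : E u w = E v w := by
      have : ∑ w, (E u w - E v w) * (E u w - E v w) = 0 := by
        have (w : X) : (E u w - E v w) * (E u w - E v w) =
            E u w * E u w - 2 * (E u w * E v w) + E v w * E v w := by ring
        simp_rw [this, Finset.sum_add_distrib, Finset.sum_sub_distrib, ← Finset.mul_sum, hsq, E0,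
          E1 huv, he]
        ring
      rw [Finset.sum_eq_zero_iff_of_nonneg fun _ _ => mul_self_nonneg _] at this
      exact sub_eq_zero.1 (mul_self_eq_zero.1 (this w (Finset.mem_univ w)))
    have hall {u v : X} (p : Γ.Walk u v) (w : X) : E u w = E v w := by
      induction p with
      | nil => rfl
      | cons huv _ ih => exact (hrows huv _).trans ih
    obtain ⟨x⟩ := ‹Nonempty X›
    have hcol (u : X) : E x u = e0 := by
      rw [hsymm, hall (hconn u x).some, E0]
    have := hrow x
    simp [hcol, he0, hn] at this
  refine ⟨e0, e1, e2, ⟨he0, he01, fun he => ?_⟩, E0, fun _ _ => E1, fun _ _ => E2, hsq⟩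
  -- If `e0 = e2` then `E` has only two distinct entries, so `E ⊙ E` lies in the span of `E` and
  -- the all-one matrix, contrary to `q 1 1 2 ≠ 0`.
  refine (hqF 2 1 1).2 (.inl rfl) ?_
  have hEE : E ⊙ E = (e0 + e1) • F 1 + (-(e0 * e1) * Fintype.card X) • F 0 := by
    rw [hF.trivial_eq, smul_smul, mul_assoc, mul_inv_cancel₀ hn, ← hEdef]
    ext u v
    by_cases huv : u = v
    · subst huv
      simp [E0]
      ring
    by_cases hadj : Γ.Adj u v
    · simp [E1 hadj]
      ring
    · simp [E2 huv hadj, ← he]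
      ring
  have hli := Fintype.linearIndependent_iff.1 hF.linearIndependent
    ((Fintype.card X : ℝ)⁻¹ • q 1 1 - ![-(e0 * e1) * Fintype.card X, e0 + e1, 0]) (by
      have := (hq 1 1).symm.trans hEE
      rw [← sub_eq_zero] at this
      rw [← this, show ∑ h, q 1 1 h • F h = _ from Fin.sum_univ_three _]
      refine (Fin.sum_univ_three _).trans ?_
      simp only [Pi.sub_apply, Pi.smul_apply, smul_eq_mul, Matrix.cons_val]
      module) 2
  simpa [hn] using hli

theorem isQuadrangle_of_not_linearIndependent (hΓ : IsDistanceRegular Γ) (hdiam : Γ.diam = 2)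
    {E : Matrix X X ℝ} (hE : IsQPolynomial Γ 2 E) {x y z : X} (hxy : Γ.Adj x y) (hxz : Γ.Adj x z)
    (hyz : Γ.Adj y z) (hdep : ¬ LinearIndependent ℝ
      ![E *ᵥ Pi.single x 1, E *ᵥ Pi.single y 1, E *ᵥ Pi.single z 1]) :
    IsQuadrangle Γ := by
  obtain ⟨e0, e1, e2, ⟨he0, he01, he02⟩, E0, E1, E2, hsq⟩ := hE.exists_entries hΓ hdiam
  obtain ⟨hconn, a, b, c, H⟩ := hΓ
  have : Nonempty X := hconn.nonempty
  have he : e0 + 2 * e1 = 0 := by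
    rw [Fintype.linearIndependent_iff] at hdep
    push Not at hdep
    obtain ⟨g, hg, hg0⟩ := hdep
    have hw (w : X) : g 0 * E w x + g 1 * E w y + g 2 * E w z = 0 := by
      simpa [Fin.sum_univ_three] using congrFun hg w
    have hx := hw x
    have hy := hw y
    have hz := hw z
    rw [E0, E1 _ _ hxy, E1 _ _ hxz] at hx
    rw [E0, E1 _ _ hxy.symm, E1 _ _ hyz] at hy
    rw [E0, E1 _ _ hxz.symm, E1 _ _ hyz.symm] at hz
    have h01 : g 0 = g 1 := by
      refine mul_right_cancel₀ (sub_ne_zero.2 he01) ?_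
      linear_combination hx - hy
    have h02 : g 0 = g 2 := by
      refine mul_right_cancel₀ (sub_ne_zero.2 he01) ?_
      linear_combination hx - hz
    have hg0' : g 0 ≠ 0 := by
      obtain ⟨i, hi⟩ := hg0
      fin_cases i
      · exact hi
      · exact h01 ▸ hi
      · exact h02 ▸ hi
    refine (mul_eq_zero.1 ?_).resolve_left hg0'
    rw [← h01, ← h02] at hx
    linear_combination hx
  have he1 : e1 ≠ 0 := by
    rintro rfl
    exact he0 (by linarith)
  -- For each triangle, the sum of its three rows has squared norm `3 * (e0 + 2 * e1) = 0`.
  have hsum {u v w : X} (huv : Γ.Adj u v) (huw : Γ.Adj u w) (hvw : Γ.Adj v w) (s : X) :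
      E u s + E v s + E w s = 0 := by
    have : ∑ s, (E u s + E v s + E w s) * (E u s + E v s + E w s) = 0 := by
      have (s : X) : (E u s + E v s + E w s) * (E u s + E v s + E w s) =
          E u s * E u s + E v s * E v s + E w s * E w s +
            2 * (E u s * E v s) + 2 * (E u s * E w s) + 2 * (E v s * E w s) := by ring
      simp_rw [this, Finset.sum_add_distrib, ← Finset.mul_sum, hsq, E0, E1 _ _ huv, E1 _ _ huw,
        E1 _ _ hvw]
      linear_combination 3 * he
    rw [Finset.sum_eq_zero_iff_of_nonneg fun _ _ => mul_self_nonneg _] at this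
    exact mul_self_eq_zero.1 (this s (Finset.mem_univ s))
  have unique {u v w s : X} (huv : Γ.Adj u v) (huw : Γ.Adj u w) (hvw : Γ.Adj v w)
      (hus : Γ.Adj u s) (hvs : Γ.Adj v s) : w = s := by
    by_contra hne
    have := hsum huv huw hvw s
    rw [E1 _ _ hus, E1 _ _ hvs] at this
    by_cases hws : Γ.Adj w s
    · rw [E1 _ _ hws] at this
      exact he1 (by linarith)
    · rw [E2 _ _ hne hws] at this
      exact he02 (by linarith)
  have off {u v w s : X} (huv : Γ.Adj u v) (huw : Γ.Adj u w) (hvw : Γ.Adj v w)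
      (hu : s ≠ u) (hv : s ≠ v) (hw : s ≠ w) (hsu : ¬ Γ.Adj s u) (hsv : ¬ Γ.Adj s v)
      (hsw : ¬ Γ.Adj s w) : e2 = 0 := by
    have := hsum huv huw hvw s
    rw [E2 _ _ hu.symm (mt .symm hsu), E2 _ _ hv.symm (mt .symm hsv),
      E2 _ _ hw.symm (mt .symm hsw)] at this
    linarith
  have he2 : e2 ≠ 0 := by
    rintro rfl
    -- A vertex off the triangle has no neighbour on it, so the triangle is a component.
    have hclosed {u v : X} (p : Γ.Walk u v) : (u = x ∨ u = y ∨ u = z) → v = x ∨ v = y ∨ v = z := by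
      induction p with
      | nil => exact id
      | @cons u s v hus _ ih =>
        refine fun hu => ih ?_
        by_contra! hs
        have := hsum hxy hxz hyz s
        have hval (u : X) (hne : s ≠ u) : E u s = 0 ∨ E u s = e1 := by
          by_cases h : Γ.Adj u s
          · exact .inr (E1 _ _ h)
          · exact .inl (E2 _ _ hne.symm h)
        have hx := hval x hs.1
        have hy := hval y hs.2.1
        have hz := hval z hs.2.2
        have hu1 := E1 _ _ hus
        rcases hu with rfl | rfl | rfl <;> rcases hx with hx | hx <;> rcases hy with hy | hy <;>
          rcases hz with hz | hz <;> exact he1 (by linarith)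
    obtain ⟨u, v, huv⟩ := exists_dist_eq_two hdiam
    obtain ⟨hne, hadj⟩ := (dist_eq_two hconn (dist_le_two hdiam)).1 huv
    have hu := hclosed (hconn x u).some (.inl rfl)
    have hv := hclosed (hconn x v).some (.inl rfl)
    rcases hu with rfl | rfl | rfl <;> rcases hv with rfl | rfl | rfl <;>
      simp_all [Γ.adj_comm]
  refine ⟨fun {u v} huv => ?_, unique, fun huv huw hvw s hu hv hw => ?_⟩
  · refine Set.nonempty_of_ncard_ne_zero (s := {w | Γ.Adj u w ∧ Γ.Adj v w}) ?_
    rw [H.ncard_commonNeighbors huv, ← H.ncard_commonNeighbors hxy]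
    exact Set.ncard_ne_zero_of_mem (a := z) ⟨hxz, hyz⟩
  · by_contra! hcon
    exact he2 (off huv huw hvw hu hv hw hcon.1 hcon.2.1 hcon.2.2)

end

/-- The valency is twice the number of common neighbours of two vertices at distance 2, since each
line through one of them carries exactly one common neighbour. -/
theorem IsQuadrangle.exists_order {X : Type*} [Finite X] {Γ : SimpleGraph X} (h : IsQuadrangle Γ)
    (hΓ : IsDistanceRegular Γ) (hdiam : Γ.diam = 2) :
    ∃ t, 1 ≤ t ∧ ∀ x, (Γ.neighborSet x).ncard = 2 * (t + 1) := by
  obtain ⟨hconn, a, b, c, H⟩ := hΓ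
  have : Nonempty X := hconn.nonempty
  obtain ⟨x, y, hd⟩ := exists_dist_eq_two hdiam
  obtain ⟨hne, hxy⟩ := (dist_eq_two hconn (DRG.dist_le_two hdiam)).1 hd
  set C := {w | Γ.Adj x w ∧ Γ.Adj y w} with hC
  have hdeg (u : X) : (Γ.neighborSet u).ncard = 2 * C.ncard := by
    rw [H.ncard_neighborSet, ← H.ncard_neighborSet x, h.ncard_neighborSet_eq hne hxy]
  have : Nontrivial X := ⟨x, y, hne⟩
  obtain ⟨w, hxw⟩ := hconn.preconnected.exists_adj_of_nontrivial x
  obtain ⟨p, hp⟩ : C.Nonempty := by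
    refine Set.nonempty_of_ncard_ne_zero fun h0 => ?_
    have := hdeg x
    rw [h0, mul_zero, Set.ncard_eq_zero] at this
    exact (Set.eq_empty_iff_forall_notMem.1 this) w hxw
  -- The neighbours of `p` include `y` and the line through `x` and `p`.
  obtain ⟨x', hxx', hpx'⟩ := h.exists_third hp.1
  have h3 : ({x, x', y} : Set X).ncard = 3 := by
    rw [Set.ncard_eq_three]
    exact ⟨x, x', y, hxx'.ne, hne, by rintro rfl; exact hxy hxx', rfl⟩
  have hle : ({x, x', y} : Set X).ncard ≤ (Γ.neighborSet p).ncard := by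
    refine Set.ncard_le_ncard ?_
    rintro v (rfl | rfl | rfl)
    exacts [hp.1.symm, hpx', hp.2.symm]
  rw [hdeg, h3] at hle
  exact ⟨C.ncard - 1, by lia, fun u => by rw [hdeg]; lia⟩

end DRG

theorem mainTheorem8 :
    ∃ (n : ℕ → ℕ) (Δ : ∀ t : ℕ, SimpleGraph (Fin (n t))),
      (∀ t ∈ ({1, 2, 4} : Set ℕ),
        DRG.IsRegularNearPolygon (Δ t) 2 ∧ DRG.HasOrder (Δ t) 2 t ∧
          ∀ (Y : Type*) [Fintype Y] (Λ : SimpleGraph Y),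
            DRG.IsRegularNearPolygon Λ 2 → DRG.HasOrder Λ 2 t → Nonempty (Λ ≃g Δ t)) ∧
      ∀ (X : Type*) [Fintype X] [DecidableEq X] (Γ : SimpleGraph X) [DecidableRel Γ.Adj]
        (E : Matrix X X ℝ),
        DRG.IsDistanceRegular Γ → Γ.diam = 2 → DRG.IsQPolynomial Γ 2 E →
        (∃ x y z : X, Γ.Adj x y ∧ Γ.Adj x z ∧ Γ.Adj y z ∧
          ¬ LinearIndependent ℝ
            ![E *ᵥ Pi.single x 1, E *ᵥ Pi.single y 1, E *ᵥ Pi.single z 1]) →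
        ∃ t ∈ ({1, 2, 4} : Set ℕ), Nonempty (Γ ≃g Δ t) := by
  have e (t : ℕ) : DRG.Coord.graph t ≃g (DRG.Coord.graph t).overFin rfl :=
    (DRG.Coord.graph t).overFinIso rfl
  refine ⟨_, fun t => (DRG.Coord.graph t).overFin rfl, fun t ht => ?_, ?_⟩
  · have ht' : t = 1 ∨ t = 2 ∨ t = 4 := by simpa using ht
    have hQ : DRG.IsQuadrangle ((DRG.Coord.graph t).overFin rfl) :=
      (DRG.Coord.isQuadrangle_graph ht').of_iso (e t)
    have hdeg (x) : (((DRG.Coord.graph t).overFin rfl).neighborSet x).ncard = 2 * (t + 1) := by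
      rw [← DRG.Coord.ncard_neighborSet_graph ht' ((e t).symm x)]
      exact Set.ncard_congr' ((e t).symm.mapNeighborSet x)
    have : Nonempty {u : DRG.Coord t // u.IsPoint} :=
      Fintype.card_pos_iff.1 (by rw [DRG.Coord.card_isPoint ht']; lia)
    have := (e t).symm.toEquiv.nonempty
    obtain ⟨h1, h2⟩ := hQ.isRegularNearPolygon (by lia) hdeg
    refine ⟨h1, h2, fun Y _ Λ hΛ ho => ?_⟩
    have := hΛ.distanceRegular.1.nonempty
    obtain ⟨hΛQ, hΛdeg⟩ := hΛ.isQuadrangle ho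
    obtain ⟨-, ⟨f⟩⟩ := hΛQ.nonempty_iso (by lia) hΛdeg
    exact ⟨f.trans (e t)⟩
  · rintro X _ _ Γ _ E hΓ hdiam hE ⟨x, y, z, hxy, hxz, hyz, hdep⟩
    have := hΓ.1.nonempty
    have hQ := DRG.isQuadrangle_of_not_linearIndependent hΓ hdiam hE hxy hxz hyz hdep
    obtain ⟨t, ht, hdeg⟩ := hQ.exists_order hΓ hdiam
    obtain ⟨ht', ⟨f⟩⟩ := hQ.nonempty_iso ht hdeg
    exact ⟨t, by simpa using ht', ⟨f.trans (e t)⟩⟩
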